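/- **Theorem 3.1.** For $a,b\in\mathbb{C}$ let $\mathcal{W}(a,b)$ be the Lie conformal algebra that is free over $\mathbb{C}[\partial]$ with basis $L,W$ and has $\lambda$-brackets $$[L_\lambda L]=(\partial+2\lambda)L,\qquad [L_\lambda W]=(\partial+a\lambda+b)W,\qquad [W_\lambda W]=0 .$$ A conformal module over a Lie conformal algebra $\mathcal{R}$ is a $\mathbb{C}[\partial]$-module $M$ with a $\mathbb{C}$-linear map $\mathcal{R}\otimes M\to\mathbb{C}[\lambda]\otimes M$, $x\otimes v\mapsto x_\lambda v$, such that $(\partial x)_\lambda v=-\lambda\, x_\lambda v$, $x_\lambda(\partial v)=(\partial+\lambda)x_\lambda v$ and $x_\lambda(y_\mu v)-y_\mu(x_\lambda v)=[x_\lambda y]_{\lambda+\mu}v$. It is finite if it is finitely generated over $\mathbb{C}[\partial]$, trivial if $x_\lambda v=0$ for all $x,v$, and irreducible if it is nonzero and its only conformal submodules are $0$ and itself. An isomorphism of conformal modules is a $\mathbb{C}[\partial]$-linear bijection that commutes with the $\lambda$-actions. 1. Let $a\neq1$ or $b\neq0$. Every finite nontrivial irreducible conformal module over $\mathcal{W}(a,b)$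 is free of rank one over $\mathbb{C}[\partial]$, and it is isomorphic, for some $\alpha,\beta\in\mathbb{C}$ with $\alpha\neq0$, to the module $$M_{\alpha,\beta}=\mathbb{C}[\partial]v,\qquad L_\lambda v=(\partial+\alpha\lambda+\beta)v,\qquad W_\lambda v=0 .$$ 2. Every finite nontrivial irreducible conformal module over $\mathcal{W}(1,0)$ is free of rank one over $\mathbb{C}[\partial]$, and it is isomorphic, for some $\alpha,\beta,\gamma\in\mathbb{C}$ with $\alpha\neq0$ or $\gamma\neq0$, to the module $$M_{\alpha,\beta,\gamma}=\mathbb{C}[\partial]v,\qquad L_\lambda v=(\partial+\alpha\lambda+\beta)v,\qquad W_\lambda v=\gamma v .$$ -/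

import Mathlib

open Polynomial

noncomputable section

namespace LieConf

/- Conventions.  A `ℂ[∂]`-module is a module over `ℂ[X]`, with `∂` acting as `X`; its complex vector
space structure is the compatible one (`IsScalarTower ℂ ℂ[X] M`).  The space `ℂ[λ] ⊗ M` is Mathlib's
`PolynomialModule ℂ M`: an element is a polynomial in `λ` with coefficients in `M`, and
`PolynomialModule.eval l` is its value in `M` at `λ = l`.  An identity between polynomials in `λ`
(and `μ`) with coefficients in a complex vector space is stated as the equality of their values at
all complex numbers, which is the same thing because `ℂ` is infinite. -/

/-- The substitution `λ ↦ q(∂)` in an element `∑ λ ^ j ⊗ m_j` of `ℂ[λ] ⊗ M`, with the powers of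
`q(∂)` put to the left of the coefficients: the element `∑ q(∂) ^ j m_j` of `M`. -/
def subst {M : Type*} [AddCommGroup M] [Module ℂ M] [Module ℂ[X] M] [IsScalarTower ℂ ℂ[X] M]
    (q : ℂ[X]) (p : PolynomialModule ℂ M) : M :=
  PolynomialModule.eval q (PolynomialModule.map ℂ[X] (LinearMap.id : M →ₗ[ℂ] M) p)

/-- A Lie conformal algebra structure on the `ℂ[∂]`-module `R`. -/
structure LieConformalAlgebra (R : Type*) [AddCommGroup R] [Module ℂ R] [Module ℂ[X] R]
    [IsScalarTower ℂ ℂ[X] R] where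
  /-- the `λ`-bracket `a ⊗ b ↦ [a_λ b]` -/
  bracket : R →ₗ[ℂ] R →ₗ[ℂ] PolynomialModule ℂ R
  /-- `[∂a_λ b] = -λ [a_λ b]` -/
  bracket_deriv_left : ∀ (a b : R) (l : ℂ),
    (bracket ((X : ℂ[X]) • a) b).eval l = -l • (bracket a b).eval l
  /-- `[a_λ ∂b] = (∂ + λ) [a_λ b]` -/
  bracket_deriv_right : ∀ (a b : R) (l : ℂ),
    (bracket a ((X : ℂ[X]) • b)).eval l = (X + C l : ℂ[X]) • (bracket a b).eval l
  /-- `[a_λ b] = -[b_{-λ-∂} a]` -/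
  skew : ∀ (a b : R) (l : ℂ), (bracket a b).eval l = -subst (-C l - X) (bracket b a)
  /-- `[a_λ [b_μ c]] = [[a_λ b]_{λ+μ} c] + [b_μ [a_λ c]]` -/
  jacobi : ∀ (a b c : R) (l m : ℂ),
    (bracket a ((bracket b c).eval m)).eval l =
      (bracket ((bracket a b).eval l) c).eval (l + m) + (bracket b ((bracket a c).eval l)).eval m

/-- A conformal module structure on the `ℂ[∂]`-module `M` over the Lie conformal algebra `A`. -/
structure ConformalModule {R : Type*} [AddCommGroup R] [Module ℂ R] [Module ℂ[X] R]
    [IsScalarTower ℂ ℂ[X] R] (A : LieConformalAlgebra R)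
    (M : Type*) [AddCommGroup M] [Module ℂ M] [Module ℂ[X] M] [IsScalarTower ℂ ℂ[X] M] where
  /-- the `λ`-action `a ⊗ v ↦ a_λ v` -/
  act : R →ₗ[ℂ] M →ₗ[ℂ] PolynomialModule ℂ M
  /-- `(∂a)_λ v = -λ (a_λ v)` -/
  act_deriv_left : ∀ (a : R) (v : M) (l : ℂ),
    (act ((X : ℂ[X]) • a) v).eval l = -l • (act a v).eval l
  /-- `a_λ (∂v) = (∂ + λ) (a_λ v)` -/
  act_deriv_right : ∀ (a : R) (v : M) (l : ℂ),
    (act a ((X : ℂ[X]) • v)).eval l = (X + C l : ℂ[X]) • (act a v).eval l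
  /-- `a_λ (b_μ v) - b_μ (a_λ v) = [a_λ b]_{λ+μ} v` -/
  act_bracket : ∀ (a b : R) (v : M) (l m : ℂ),
    (act a ((act b v).eval m)).eval l - (act b ((act a v).eval l)).eval m =
      (act ((A.bracket a b).eval l) v).eval (l + m)

namespace ConformalModule

variable {R : Type*} [AddCommGroup R] [Module ℂ R] [Module ℂ[X] R] [IsScalarTower ℂ ℂ[X] R]
  {A : LieConformalAlgebra R}
  {M : Type*} [AddCommGroup M] [Module ℂ M] [Module ℂ[X] M] [IsScalarTower ℂ ℂ[X] M]
  {N : Type*} [AddCommGroup N] [Module ℂ N] [Module ℂ[X] N] [IsScalarTower ℂ ℂ[X] N]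

/-- The module is trivial: `a_λ v = 0` for all `a` and `v`. -/
def IsTrivial (ρ : ConformalModule A M) : Prop :=
  ∀ (a : R) (v : M), ρ.act a v = 0

/-- The `ℂ[∂]`-submodule `U` is a conformal submodule: `a_λ u ∈ ℂ[λ] ⊗ U` for `u ∈ U`. -/
def IsSubmodule (ρ : ConformalModule A M) (U : Submodule ℂ[X] M) : Prop :=
  ∀ (a : R), ∀ u ∈ U, ∀ n : ℕ, (ρ.act a u).coeff n ∈ U

/-- The module is nonzero and has no conformal submodules other than zero and itself. -/
def IsIrreducible (ρ : ConformalModule A M) : Prop :=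
  Nontrivial M ∧ ∀ U : Submodule ℂ[X] M, ρ.IsSubmodule U → U = ⊥ ∨ U = ⊤

/-- Isomorphism of conformal modules: a `ℂ[∂]`-linear bijection that commutes with the
`λ`-action, coefficient by coefficient. -/
def Isomorphic (ρ : ConformalModule A M) (σ : ConformalModule A N) : Prop :=
  ∃ e : M ≃ₗ[ℂ[X]] N, ∀ (a : R) (v : M) (n : ℕ),
    e ((ρ.act a v).coeff n) = (σ.act a (e v)).coeff n

end ConformalModule

/-- The element `∂` of `ℂ[∂][λ] = ℂ[X][X]`. -/
abbrev del : ℂ[X][X] := C X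

/-- The element `λ` of `ℂ[∂][λ] = ℂ[X][X]`. -/
abbrev lam : ℂ[X][X] := X

/-- A complex number as a constant of `ℂ[∂][λ] = ℂ[X][X]`. -/
abbrev con (c : ℂ) : ℂ[X][X] := C (C c)

/-- For generators `x`, `y`, `z` with `x_λ y = h(∂, λ) z`, the `λ`-product extended by
sesquilinearity: `(f(∂) x)_λ (g(∂) y) = f(-λ) g(∂ + λ) h(∂, λ) z`, as the coefficient of `z`. -/
def sesq (h : ℂ[X][X]) : ℂ[X] →ₗ[ℂ] ℂ[X] →ₗ[ℂ] PolynomialModule ℂ ℂ[X] :=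
  LinearMap.mk₂ ℂ
    (fun f g => PolynomialModule.equivPolynomial.symm (aeval (-lam) f * aeval (del + lam) g * h))
    (fun f f' g => by simp only [map_add, add_mul])
    (fun c f g => by simp only [map_smul, smul_mul_assoc])
    (fun f g g' => by simp only [map_add, mul_add, add_mul])
    (fun c f g => by simp only [map_smul, mul_smul_comm, smul_mul_assoc])

theorem eval_equivPolynomial_symm (P : ℂ[X][X]) (l : ℂ) :
    (PolynomialModule.equivPolynomial.symm P : PolynomialModule ℂ ℂ[X]).eval l =
      P.eval (C l) := by
  induction P using Polynomial.induction_on' with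
  | add p q hp hq => simp only [map_add, hp, hq, eval_add]
  | monomial n x =>
    simp only [PolynomialModule.equivPolynomial_symm_monomial, PolynomialModule.eval_single,
      eval_monomial, ← C_pow, smul_eq_C_mul, mul_comm]

theorem subst_equivPolynomial_symm (P : ℂ[X][X]) (q : ℂ[X]) :
    subst q (PolynomialModule.equivPolynomial.symm P : PolynomialModule ℂ ℂ[X]) = P.eval q := by
  unfold subst
  induction P using Polynomial.induction_on' with
  | add p q hp hq => simp only [map_add, hp, hq, eval_add]
  | monomial n x =>
    simp only [PolynomialModule.equivPolynomial_symm_monomial, PolynomialModule.map_single,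
      PolynomialModule.eval_single, eval_monomial, LinearMap.id_apply, smul_eq_mul, mul_comm]

theorem eval_aeval (x : ℂ[X][X]) (q f : ℂ[X]) : (aeval x f).eval q = aeval (x.eval q) f := by
  induction f using Polynomial.induction_on' with
  | add p q hp hq => simp only [map_add, hp, hq, eval_add]
  | monomial n c =>
    simp only [aeval_monomial, eval_mul, eval_pow]
    congr 1
    exact eval_C

theorem eval_sesq (h : ℂ[X][X]) (f g : ℂ[X]) (l : ℂ) :
    (sesq h f g).eval l = C (f.eval (-l)) * taylor l g * h.eval (C l) := by
  have h1 : aeval (-C l : ℂ[X]) f = C (f.eval (-l)) := by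
    rw [← C_neg]
    exact (aeval_algebraMap_apply ℂ[X] (-l) f).trans (by simp)
  have h2 : aeval (X + C l : ℂ[X]) g = taylor l g := by
    rw [taylor_apply, comp_eq_aeval]
  simp only [sesq, LinearMap.mk₂_apply, eval_equivPolynomial_symm, eval_mul, eval_aeval,
    eval_add, eval_neg, eval_C, eval_X, h1, h2]

theorem subst_sesq (h : ℂ[X][X]) (f g : ℂ[X]) (l : ℂ) :
    subst (-C l - X) (sesq h f g) = taylor l f * C (g.eval (-l)) * h.eval (-C l - X) := by
  have h1 : aeval (-C l : ℂ[X]) g = C (g.eval (-l)) := by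
    rw [← C_neg]
    exact (aeval_algebraMap_apply ℂ[X] (-l) g).trans (by simp)
  have h2 : aeval (X + C l : ℂ[X]) f = taylor l f := by
    rw [taylor_apply, comp_eq_aeval]
  have e1 : -(-C l - X : ℂ[X]) = X + C l := by ring
  have e2 : (X + (-C l - X) : ℂ[X]) = -C l := by ring
  simp only [sesq, LinearMap.mk₂_apply, subst_equivPolynomial_symm, eval_mul, eval_aeval,
    eval_add, eval_neg, eval_C, eval_X, e1, e2, h1, h2]

/-- The underlying `ℂ[∂]`-module of `W(a, b)`: free on `L = (1, 0)` and `W = (0, 1)`. -/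
abbrev WCarrier : Type := ℂ[X] × ℂ[X]

/-- The `λ`-bracket of `W(a, b)`, with `[L_λ L] = (∂ + 2λ) L`, `[L_λ W] = (∂ + aλ + b) W`,
`[W_λ W] = 0`, and `[W_λ L] = ((a - 1)∂ + aλ - b) W`, the value forced by skew-symmetry. -/
def WBracket (a b : ℂ) : WCarrier →ₗ[ℂ] WCarrier →ₗ[ℂ] PolynomialModule ℂ WCarrier :=
  ((sesq (del + con 2 * lam)).compl₁₂ (LinearMap.fst ℂ ℂ[X] ℂ[X])
      (LinearMap.fst ℂ ℂ[X] ℂ[X])).compr₂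
      (PolynomialModule.map ℂ (LinearMap.inl ℂ ℂ[X] ℂ[X]))
  + ((sesq (del + con a * lam + con b)).compl₁₂ (LinearMap.fst ℂ ℂ[X] ℂ[X])
      (LinearMap.snd ℂ ℂ[X] ℂ[X])).compr₂
      (PolynomialModule.map ℂ (LinearMap.inr ℂ ℂ[X] ℂ[X]))
  + ((sesq (con (a - 1) * del + con a * lam - con b)).compl₁₂ (LinearMap.snd ℂ ℂ[X] ℂ[X])
      (LinearMap.fst ℂ ℂ[X] ℂ[X])).compr₂
      (PolynomialModule.map ℂ (LinearMap.inr ℂ ℂ[X] ℂ[X]))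

theorem eval_map_inl (l : ℂ) (p : PolynomialModule ℂ ℂ[X]) :
    (PolynomialModule.map ℂ (LinearMap.inl ℂ ℂ[X] ℂ[X]) p).eval l = (p.eval l, 0) :=
  PolynomialModule.eval_map ℂ (LinearMap.inl ℂ ℂ[X] ℂ[X]) p l

theorem eval_map_inr (l : ℂ) (p : PolynomialModule ℂ ℂ[X]) :
    (PolynomialModule.map ℂ (LinearMap.inr ℂ ℂ[X] ℂ[X]) p).eval l = (0, p.eval l) :=
  PolynomialModule.eval_map ℂ (LinearMap.inr ℂ ℂ[X] ℂ[X]) p l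

theorem eval_WBracket (a b : ℂ) (x y : WCarrier) (l : ℂ) :
    (WBracket a b x y).eval l =
      (C (x.1.eval (-l)) * taylor l y.1 * (X + C 2 * C l),
       C (x.1.eval (-l)) * taylor l y.2 * (X + C a * C l + C b) +
       C (x.2.eval (-l)) * taylor l y.1 * (C (a - 1) * X + C a * C l - C b)) := by
  simp only [WBracket, LinearMap.add_apply, LinearMap.compr₂_apply, LinearMap.compl₁₂_apply,
    map_add, eval_map_inl, eval_map_inr, LinearMap.fst_apply, LinearMap.snd_apply, eval_sesq,
    eval_add, eval_sub, eval_mul, eval_C, eval_X]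
  ext <;> simp

theorem subst_map_inl (q : ℂ[X]) (p : PolynomialModule ℂ ℂ[X]) :
    subst q (PolynomialModule.map ℂ (LinearMap.inl ℂ ℂ[X] ℂ[X]) p) = (subst q p, 0) := by
  unfold subst
  induction p using PolynomialModule.induction_linear with
  | zero => simp only [map_zero, Prod.mk_zero_zero]
  | add x y hx hy => simp only [map_add, hx, hy, Prod.mk_add_mk, add_zero]
  | single n m => simp

theorem subst_map_inr (q : ℂ[X]) (p : PolynomialModule ℂ ℂ[X]) :
    subst q (PolynomialModule.map ℂ (LinearMap.inr ℂ ℂ[X] ℂ[X]) p) = (0, subst q p) := by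
  unfold subst
  induction p using PolynomialModule.induction_linear with
  | zero => simp only [map_zero, Prod.mk_zero_zero]
  | add x y hx hy => simp only [map_add, hx, hy, Prod.mk_add_mk, add_zero]
  | single n m => simp

theorem subst_add {M : Type*} [AddCommGroup M] [Module ℂ M] [Module ℂ[X] M]
    [IsScalarTower ℂ ℂ[X] M] (q : ℂ[X]) (p p' : PolynomialModule ℂ M) :
    subst q (p + p') = subst q p + subst q p' := by
  simp only [subst, map_add]

theorem subst_WBracket (a b : ℂ) (x y : WCarrier) (l : ℂ) :
    subst (-C l - X) (WBracket a b x y) =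
      (taylor l x.1 * C (y.1.eval (-l)) * (X + C 2 * (-C l - X)),
       taylor l x.1 * C (y.2.eval (-l)) * (X + C a * (-C l - X) + C b) +
       taylor l x.2 * C (y.1.eval (-l)) * (C (a - 1) * X + C a * (-C l - X) - C b)) := by
  simp only [WBracket, LinearMap.add_apply, LinearMap.compr₂_apply, LinearMap.compl₁₂_apply,
    subst_add, subst_map_inl, subst_map_inr, LinearMap.fst_apply, LinearMap.snd_apply, subst_sesq,
    eval_add, eval_sub, eval_mul, eval_C, eval_X]
  ext <;> simp

/-- The Lie conformal algebra `W(a, b)`. -/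
def W (a b : ℂ) : LieConformalAlgebra WCarrier where
  bracket := WBracket a b
  bracket_deriv_left x y l := by
    simp only [eval_WBracket, Prod.smul_fst, Prod.smul_snd, smul_eq_mul, eval_mul, eval_X,
      C_mul, C_neg, Prod.smul_mk, smul_eq_C_mul]
    ext1 <;> ring
  bracket_deriv_right x y l := by
    simp only [eval_WBracket, Prod.smul_fst, Prod.smul_snd, smul_eq_mul, taylor_mul, taylor_X,
      Prod.smul_mk]
    ext1 <;> ring
  skew x y l := by
    simp only [eval_WBracket, subst_WBracket, Prod.neg_mk, C_sub, C_1,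
      show (C (2 : ℂ) : ℂ[X]) = 2 from rfl]
    ext1 <;> ring
  jacobi x y z l m := by
    have e1 : -(l + m) + l = -m := by ring
    simp only [eval_WBracket, Prod.mk_add_mk, taylor_mul, taylor_C, taylor_X, map_add, map_sub,
      taylor_taylor, eval_mul, eval_add, eval_sub, eval_C, eval_X, taylor_eval, e1, C_mul,
      C_neg, add_comm m l]
    simp only [C_1, show (C (2 : ℂ) : ℂ[X]) = 2 from rfl]
    ext1 <;> ring

/-- The rank one module `M_{α,β} = ℂ[∂]v` over `W(a, b)`, with `L_λ v = (∂ + αλ + β) v` and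
`W_λ v = 0`; here `v = 1`. -/
def Mab (a b α β : ℂ) : ConformalModule (W a b) ℂ[X] where
  act := (sesq (del + con α * lam + con β)).comp (LinearMap.fst ℂ ℂ[X] ℂ[X])
  act_deriv_left x v l := by
    simp only [LinearMap.comp_apply, LinearMap.fst_apply, eval_sesq, Prod.smul_fst, smul_eq_mul,
      eval_mul, eval_X, C_mul, C_neg, smul_eq_C_mul]
    ring
  act_deriv_right x v l := by
    simp only [LinearMap.comp_apply, LinearMap.fst_apply, eval_sesq, smul_eq_mul, taylor_mul,
      taylor_X]
    ring
  act_bracket x y v l m := by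
    have e1 : -(l + m) + l = -m := by ring
    simp only [W, LinearMap.comp_apply, LinearMap.fst_apply, eval_WBracket, eval_sesq, taylor_mul,
      taylor_C, taylor_X, map_add, taylor_taylor, eval_mul, eval_add, eval_C, eval_X, taylor_eval,
      e1, C_mul, C_neg, add_comm m l]
    simp only [show (C (2 : ℂ) : ℂ[X]) = 2 from rfl]
    ring

/-- The rank one module `M_{α,β,γ} = ℂ[∂]v` over `W(1, 0)`, with `L_λ v = (∂ + αλ + β) v` and
`W_λ v = γ v`; here `v = 1`. -/
def Mabc (α β γ : ℂ) : ConformalModule (W 1 0) ℂ[X] where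
  act := (sesq (del + con α * lam + con β)).comp (LinearMap.fst ℂ ℂ[X] ℂ[X])
    + (sesq (con γ)).comp (LinearMap.snd ℂ ℂ[X] ℂ[X])
  act_deriv_left x v l := by
    simp only [LinearMap.add_apply, map_add, LinearMap.comp_apply, LinearMap.fst_apply,
      LinearMap.snd_apply, eval_sesq, Prod.smul_fst, Prod.smul_snd, smul_eq_mul,
      eval_mul, eval_X, C_mul, C_neg, smul_eq_C_mul]
    ring
  act_deriv_right x v l := by
    simp only [LinearMap.add_apply, map_add, LinearMap.comp_apply, LinearMap.fst_apply,
      LinearMap.snd_apply, eval_sesq, smul_eq_mul, taylor_mul, taylor_X]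
    ring
  act_bracket x y v l m := by
    have e1 : -(l + m) + l = -m := by ring
    simp only [W, LinearMap.add_apply, LinearMap.comp_apply, LinearMap.fst_apply,
      LinearMap.snd_apply, eval_WBracket, eval_sesq, taylor_mul,
      taylor_C, taylor_X, map_add, taylor_taylor, eval_mul, eval_add, eval_sub, eval_C, eval_X,
      taylor_eval, e1, C_mul, C_neg, C_sub, add_comm m l]
    simp only [C_1, C_0, show (C (2 : ℂ) : ℂ[X]) = 2 from rfl]
    ring

end LieConf

end

/-! Write $x_\lambda=\sum_n \frac{\lambda^n}{n!}x_{(n)}$. The module axioms become commutators of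
modes: $[L_{(i)},L_{(j)}]=(i-j)L_{(i+j-1)}$, $[L_{(i)},W_{(j)}]=((a-1)i-j)W_{(i+j-1)}+bW_{(i+j)}$,
the $W_{(j)}$ commute, and $T=L_{(0)}-\partial$ commutes with every $L_{(j)}$ and satisfies
$[T,W_{(j)}]=bW_{(j)}$ (`mode_commutator`, `mode_X_smul`).

In a finite nontrivial irreducible module only $0$ is acted on trivially. Torsion is acted on
trivially, so the module is free of finite rank. Each vector is killed by all modes of high index,
and the space of vectors killed by the modes beyond a fixed index is finite-dimensional
(`finiteDimensional_of_isSesq`) and stable under $T$, $L_{(i+1)}$ and $W_{(i)}$. These operators act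
on it through a solvable Lie algebra, so Lie's theorem gives a common eigenvector $v$
(`exists_common_eigenvector_of_witt`). Then $L_\lambda v=(\partial+\alpha\lambda+\beta)v$ and
$W_\lambda v=g(\lambda)v$, so $\mathbb{C}[\partial]v$ is a submodule and is everything.

The bracket $[L_\lambda W]$ forces $-\mu g(\mu)=((a-1)\lambda-\mu+b)g(\lambda+\mu)$
(`symbol_relation`): $g=0$ if $a\ne1$ or $b\ne0$, and $g$ is constant otherwise. If $\alpha=0$ and
$g=0$, then $(\partial+\beta)v$ generates a proper nonzero submodule, which irreducibility excludes.
-/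

noncomputable section

namespace LieConf

/-! ### Polynomials in one and two parameters with vector coefficients. -/

section PolynomialModule

variable {M : Type*} [AddCommGroup M] [Module ℂ M]

theorem eval_eq_sum_range (p : PolynomialModule ℂ M) {n : ℕ} (hn : ∀ i, n ≤ i → p.coeff i = 0)
    (l : ℂ) : p.eval l = ∑ i ∈ Finset.range n, l ^ i • p.coeff i := by
  rw [PolynomialModule.eval_apply]
  refine Finsupp.sum_of_support_subset _ (fun i hi => ?_) _ (fun i _ => smul_zero _)
  rw [Finset.mem_range]
  by_contra h
  exact Finsupp.mem_support_iff.1 hi (hn i (not_lt.1 h))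

/-- Degree bounds are stated as eventual properties so that several polynomials can be truncated at
one common $n$. -/
theorem eventually_coeff_eq_zero (p : PolynomialModule ℂ M) :
    ∀ᶠ n in Filter.atTop, ∀ i, n ≤ i → p.coeff i = 0 := by
  filter_upwards [Filter.eventually_gt_atTop (p.coeff.support.sup id)] with n hn i hi
  by_contra h
  have := Finset.le_sup (f := id) (Finsupp.mem_support_iff.2 h)
  simp only [id] at this
  omega

/-- Linear functionals reduce this to a scalar polynomial with infinitely many roots. -/
theorem eq_zero_of_sum_pow_smul_eq_zero {n : ℕ} {x : ℕ → M}
    (h : ∀ l : ℂ, ∑ i ∈ Finset.range n, l ^ i • x i = 0) {i : ℕ} (hi : i < n) : x i = 0 := by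
  rw [← Module.forall_dual_apply_eq_zero_iff ℂ]
  intro φ
  have h0 : (∑ i ∈ Finset.range n, monomial i (φ (x i)) : ℂ[X]) = 0 := by
    refine Polynomial.funext fun l => ?_
    have := congrArg φ (h l)
    simpa [eval_finsetSum, mul_comm] using this
  have := congrArg (fun p => Polynomial.coeff p i) h0
  simpa [finsetSum_coeff, coeff_monomial, hi] using this

theorem eq_of_forall_eval_eq {p q : PolynomialModule ℂ M} (h : ∀ l, p.eval l = q.eval l) :
    p = q := by
  obtain ⟨n, hp, hq⟩ := ((eventually_coeff_eq_zero p).and (eventually_coeff_eq_zero q)).exists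
  ext i
  rcases lt_or_ge i n with hi | hi
  · refine sub_eq_zero.1 (eq_zero_of_sum_pow_smul_eq_zero (n := n)
      (x := fun i => p.coeff i - q.coeff i) (fun l => ?_) hi)
    simp only [smul_sub, Finset.sum_sub_distrib, ← eval_eq_sum_range _ hp,
      ← eval_eq_sum_range _ hq, h, sub_self]
  · rw [hp i hi, hq i hi]

theorem eq_zero_of_sum_sum_pow_smul_eq_zero {n : ℕ} {x : ℕ → ℕ → M}
    (h : ∀ l m : ℂ, ∑ i ∈ Finset.range n, ∑ j ∈ Finset.range n, (l ^ i * m ^ j) • x i j = 0)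
    {i j : ℕ} (hi : i < n) (hj : j < n) : x i j = 0 := by
  refine eq_zero_of_sum_pow_smul_eq_zero (n := n) (fun m => ?_) hj
  refine eq_zero_of_sum_pow_smul_eq_zero (n := n)
    (x := fun i => ∑ j ∈ Finset.range n, m ^ j • x i j) (fun l => ?_) hi
  simpa only [Finset.smul_sum, smul_smul] using h l m

/-- The exponential expansion of `∑ (l + m) ^ k / k! • x k`. -/
theorem sum_add_pow_div_factorial {n : ℕ} {x : ℕ → M} (hx : ∀ k, n ≤ k → x k = 0) (l m : ℂ) :
    ∑ k ∈ Finset.range n, ((l + m) ^ k / k.factorial) • x k =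
      ∑ i ∈ Finset.range n, ∑ j ∈ Finset.range n,
        (l ^ i / i.factorial * (m ^ j / j.factorial)) • x (i + j) := by
  have key : ∀ k : ℕ, ((l + m) ^ k / k.factorial) =
      ∑ p ∈ Finset.HasAntidiagonal.antidiagonal k,
        l ^ p.1 / p.1.factorial * (m ^ p.2 / p.2.factorial) := by
    intro k
    rw [(Commute.all l m).add_pow', Finset.sum_div]
    refine Finset.sum_congr rfl fun p hp => ?_
    rw [Finset.HasAntidiagonal.mem_antidiagonal] at hp
    subst hp
    have h1 : ((p.1 + p.2).choose p.1 : ℂ) * p.1.factorial * p.2.factorial =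
        (p.1 + p.2).factorial := by
      rw [Nat.choose_symm_add]
      exact_mod_cast Nat.add_choose_mul_factorial_mul_factorial p.1 p.2
    have h2 : (p.1.factorial : ℂ) ≠ 0 := Nat.cast_ne_zero.2 (Nat.factorial_ne_zero _)
    have h3 : (p.2.factorial : ℂ) ≠ 0 := Nat.cast_ne_zero.2 (Nat.factorial_ne_zero _)
    have h4 : ((p.1 + p.2).factorial : ℂ) ≠ 0 := Nat.cast_ne_zero.2 (Nat.factorial_ne_zero _)
    rw [nsmul_eq_mul]
    field_simp
    rw [← h1]
    ring
  simp only [key, Finset.sum_smul]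
  rw [← Finset.sum_product', Finset.sum_sigma']
  -- The triangle $i+j<n$ is matched with the square $i,j<n$; the rest of the square contributes
  -- zero by `hx`.
  refine Finset.sum_bij_ne_zero (fun a _ _ => (a.2.1, a.2.2)) ?_ ?_ ?_ ?_
  · rintro ⟨k, p⟩ h _
    simp only [Finset.mem_sigma, Finset.mem_range, Finset.HasAntidiagonal.mem_antidiagonal,
      Finset.mem_product] at h ⊢
    omega
  · rintro ⟨k, p⟩ h _ ⟨k', p'⟩ h' _ e
    simp only [Finset.mem_sigma, Finset.mem_range, Finset.HasAntidiagonal.mem_antidiagonal] at h h'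
    obtain ⟨rfl⟩ : p = p' := e
    obtain rfl : k = k' := h.2.symm.trans h'.2
    rfl
  · rintro ⟨i, j⟩ _ h
    have hk : i + j < n := by
      by_contra hk
      exact h (by simp [hx (i + j) (not_lt.1 hk)])
    exact ⟨⟨i + j, (i, j)⟩, by simp [hk], by simpa using h, rfl⟩
  · rintro ⟨k, p⟩ h _
    simp only [Finset.mem_sigma, Finset.mem_range, Finset.HasAntidiagonal.mem_antidiagonal] at h
    simp [h.2]

/-- Multiplication by the variable shifts an exponential generating function by one index. It raises
the degree, so `y (n - 1)` must vanish too. The default `0 - 1 = 0` is harmless because of the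
factor `i`. -/
theorem smul_sum_pow_div_factorial {n : ℕ} {y : ℕ → M} (hy : ∀ k, n ≤ k + 1 → y k = 0) (l : ℂ) :
    l • ∑ i ∈ Finset.range n, (l ^ i / i.factorial) • y i =
      ∑ i ∈ Finset.range n, (l ^ i / i.factorial) • ((i : ℂ) • y (i - 1)) := by
  cases n with
  | zero => simp
  | succ n =>
    rw [Finset.sum_range_succ, hy n le_rfl, smul_zero, add_zero, Finset.sum_range_succ',
      Nat.cast_zero, zero_smul, smul_zero, add_zero, Finset.smul_sum]
    refine Finset.sum_congr rfl fun i _ => ?_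
    rw [smul_smul, smul_smul, Nat.add_sub_cancel]
    congr 1
    have h2 : (i.factorial : ℂ) ≠ 0 := Nat.cast_ne_zero.2 (Nat.factorial_ne_zero _)
    have h3 : ((i : ℂ) + 1) ≠ 0 := Nat.cast_add_one_ne_zero i
    rw [Nat.factorial_succ]
    push_cast
    field_simp
    ring

end PolynomialModule

/-! ### Modes of operator-valued polynomials and their commutators. -/

section Mode

variable {M : Type*} [AddCommGroup M] [Module ℂ M]

/-- The mode `x_(n)` of an operator-valued polynomial `x_λ = ∑ λ ^ n / n! x_(n)`. -/
def mode (A : M →ₗ[ℂ] PolynomialModule ℂ M) (n : ℕ) : Module.End ℂ M where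
  toFun v := (n.factorial : ℂ) • (A v).coeff n
  map_add' v w := by simp
  map_smul' c v := by
    rw [map_smul, smul_comm]
    rfl

theorem mode_apply (A : M →ₗ[ℂ] PolynomialModule ℂ M) (n : ℕ) (v : M) :
    mode A n v = (n.factorial : ℂ) • (A v).coeff n := rfl

theorem mode_eq_zero_iff (A : M →ₗ[ℂ] PolynomialModule ℂ M) (n : ℕ) (v : M) :
    mode A n v = 0 ↔ (A v).coeff n = 0 := by
  rw [mode_apply, smul_eq_zero_iff_right (Nat.cast_ne_zero.2 (Nat.factorial_ne_zero _))]

theorem eventually_mode_eq_zero (A : M →ₗ[ℂ] PolynomialModule ℂ M) (v : M) :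
    ∀ᶠ n in Filter.atTop, ∀ i, n ≤ i → mode A i v = 0 := by
  simpa only [mode_eq_zero_iff] using eventually_coeff_eq_zero (A v)

theorem eval_eq_sum_mode (A : M →ₗ[ℂ] PolynomialModule ℂ M) (v : M) {n : ℕ}
    (hn : ∀ i, n ≤ i → mode A i v = 0) (l : ℂ) :
    (A v).eval l = ∑ i ∈ Finset.range n, (l ^ i / i.factorial) • mode A i v := by
  rw [eval_eq_sum_range _ fun i hi => (mode_eq_zero_iff _ _ _).1 (hn i hi)]
  refine Finset.sum_congr rfl fun i _ => ?_
  rw [mode_apply, smul_smul, div_mul_cancel₀]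
  exact Nat.cast_ne_zero.2 (Nat.factorial_ne_zero _)

theorem eventually_eval_eval_eq_sum (A B : M →ₗ[ℂ] PolynomialModule ℂ M) (v : M) :
    ∀ᶠ n in Filter.atTop, ∀ l m : ℂ, (A ((B v).eval m)).eval l =
      ∑ i ∈ Finset.range n, ∑ j ∈ Finset.range n,
        (l ^ i / i.factorial * (m ^ j / j.factorial)) • mode A i (mode B j v) := by
  obtain ⟨N, hN⟩ := (eventually_mode_eq_zero B v).exists
  -- Only finitely many `mode B j v` are nonzero, so one bound for the modes of `A` serves every
  -- `j`.
  have h : ∀ᶠ n in Filter.atTop, ∀ j ∈ Finset.range N, ∀ i, n ≤ i →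
      mode A i (mode B j v) = 0 :=
    (Filter.eventually_all_finset _).2 fun j _ => eventually_mode_eq_zero A _
  filter_upwards [h, Filter.eventually_ge_atTop N] with n hn hNn l m
  have hn' : ∀ j i, n ≤ i → mode A i (mode B j v) = 0 := by
    intro j i hi
    rcases lt_or_ge j N with hj | hj
    · exact hn j (Finset.mem_range.2 hj) i hi
    · rw [hN j hj, map_zero]
  rw [eval_eq_sum_mode B v (fun i hi => hN i (hNn.trans hi)), map_sum, map_sum, Finset.sum_comm]
  refine Finset.sum_congr rfl fun j _ => ?_
  rw [map_smul, map_smul, eval_eq_sum_mode A _ (hn' j), Finset.smul_sum]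
  refine Finset.sum_congr rfl fun i _ => ?_
  rw [smul_smul, mul_comm]

/-- Borcherds' commutator formula, for a bracket that is linear in the parameters. -/
theorem mode_commutator {A B D : M →ₗ[ℂ] PolynomialModule ℂ M} {c d e : ℂ}
    (h : ∀ v l m, (A ((B v).eval m)).eval l - (B ((A v).eval l)).eval m =
      (c * l + d * m + e) • (D v).eval (l + m)) (i j : ℕ) (v : M) :
    mode A i (mode B j v) - mode B j (mode A i v) =
      (c * i + d * j) • mode D (i + j - 1) v + e • mode D (i + j) v := by
  obtain ⟨N, hN⟩ := (eventually_mode_eq_zero D v).exists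
  obtain ⟨n, hAB, hBA, hn, hi, hj⟩ := ((eventually_eval_eval_eq_sum A B v).and
    ((eventually_eval_eval_eq_sum B A v).and ((Filter.eventually_gt_atTop N).and
    ((Filter.eventually_gt_atTop i).and (Filter.eventually_gt_atTop j))))).exists
  set x : ℕ → M := fun k => mode D k v with hx
  have hx0 : ∀ k, n ≤ k + 1 → x k = 0 := fun k hk => hN k (by omega)
  refine sub_eq_zero.1 ?_
  have h2 : ((i.factorial : ℂ)⁻¹ * (j.factorial : ℂ)⁻¹) ≠ 0 :=
    mul_ne_zero (inv_ne_zero (Nat.cast_ne_zero.2 (Nat.factorial_ne_zero _)))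
      (inv_ne_zero (Nat.cast_ne_zero.2 (Nat.factorial_ne_zero _)))
  refine (smul_eq_zero_iff_right h2).1 ?_
  -- Both sides are compared coefficientwise in $l^i m^j$. At $i=j=0$ the truncated index `i + j -
  -- 1` has coefficient zero.
  refine eq_zero_of_sum_sum_pow_smul_eq_zero (n := n)
    (x := fun i j => ((i.factorial : ℂ)⁻¹ * (j.factorial : ℂ)⁻¹) •
      (mode A i (mode B j v) - mode B j (mode A i v) -
      ((c * i + d * j) • x (i + j - 1) + e • x (i + j)))) (fun l m => ?_) hi hj
  have hF : ∀ l m : ℂ, (D v).eval (l + m) = ∑ i ∈ Finset.range n, ∑ j ∈ Finset.range n,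
      (l ^ i / i.factorial * (m ^ j / j.factorial)) • x (i + j) := fun l m => by
    rw [eval_eq_sum_mode D v (n := n) (fun i hi => hN i (by omega)),
      sum_add_pow_div_factorial (fun k hk => hx0 k (by omega))]
  have hl : ∀ l m : ℂ, l • (D v).eval (l + m) = ∑ i ∈ Finset.range n, ∑ j ∈ Finset.range n,
      (l ^ i / i.factorial * (m ^ j / j.factorial)) • ((i : ℂ) • x (i + j - 1)) := fun l m => by
    rw [hF, Finset.sum_comm, Finset.smul_sum]
    conv_rhs => rw [Finset.sum_comm]
    refine Finset.sum_congr rfl fun j _ => ?_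
    have := smul_sum_pow_div_factorial (n := n) (y := fun i => (m ^ j / j.factorial) • x (i + j))
      (fun k hk => by rw [hx0 _ (by omega), smul_zero]) l
    simp only [smul_smul] at this ⊢
    rw [this]
    refine Finset.sum_congr rfl fun i _ => ?_
    rcases i with _ | i
    · simp
    · rw [show i + 1 - 1 + j = i + 1 + j - 1 by omega]
      congr 1
      ring
  have hm : m • (D v).eval (l + m) = ∑ i ∈ Finset.range n, ∑ j ∈ Finset.range n,
      (l ^ i / i.factorial * (m ^ j / j.factorial)) • ((j : ℂ) • x (i + j - 1)) := by
    rw [add_comm l m, hl, Finset.sum_comm]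
    refine Finset.sum_congr rfl fun i _ => Finset.sum_congr rfl fun j _ => ?_
    rw [add_comm i j, mul_comm (l ^ i / _)]
  have h3 := hBA m l
  rw [Finset.sum_comm] at h3
  rw [← sub_eq_zero.2 (h v l m), hAB, h3, add_smul, add_smul, mul_smul, mul_smul, hl, hm, hF]
  simp only [Finset.smul_sum, ← Finset.sum_sub_distrib, ← Finset.sum_add_distrib]
  refine Finset.sum_congr rfl fun i _ => Finset.sum_congr rfl fun j _ => ?_
  module

/-- A sesquilinear operator-valued polynomial: `x_(n) ∂ = ∂ x_(n) + n x_(n-1)`. -/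
theorem mode_X_smul [Module ℂ[X] M] [IsScalarTower ℂ ℂ[X] M] {A : M →ₗ[ℂ] PolynomialModule ℂ M}
    (h : ∀ v l, (A ((X : ℂ[X]) • v)).eval l = (X + C l : ℂ[X]) • (A v).eval l) (n : ℕ) (v : M) :
    mode A n ((X : ℂ[X]) • v) = (X : ℂ[X]) • mode A n v + (n : ℂ) • mode A (n - 1) v := by
  obtain ⟨N, hN, hN', hn⟩ := ((eventually_mode_eq_zero A v).and
    ((eventually_mode_eq_zero A ((X : ℂ[X]) • v)).and (Filter.eventually_gt_atTop n))).exists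
  refine sub_eq_zero.1 ?_
  have h2 : ((n.factorial : ℂ)⁻¹) ≠ 0 := inv_ne_zero (Nat.cast_ne_zero.2 (Nat.factorial_ne_zero _))
  refine (smul_eq_zero_iff_right h2).1 ?_
  refine eq_zero_of_sum_pow_smul_eq_zero (n := N + 1)
    (x := fun n => (n.factorial : ℂ)⁻¹ • (mode A n ((X : ℂ[X]) • v) -
      ((X : ℂ[X]) • mode A n v + (n : ℂ) • mode A (n - 1) v))) (fun l => ?_) (hn.trans (by simp))
  have h3 := sub_eq_zero.2 (h v l)
  have h4 : (C l : ℂ[X]) • (A v).eval l = l • (A v).eval l := by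
    rw [← algebraMap_smul ℂ[X] l, algebraMap_eq]
  rw [add_smul, h4, eval_eq_sum_mode A v (n := N + 1) (fun i hi => hN i (by omega)),
    eval_eq_sum_mode A _ (n := N + 1) (fun i hi => hN' i (by omega)),
    smul_sum_pow_div_factorial (fun k hk => hN k (by omega)), Finset.smul_sum,
    ← Finset.sum_add_distrib, ← Finset.sum_sub_distrib] at h3
  rw [← h3]
  refine Finset.sum_congr rfl fun i _ => ?_
  rw [smul_comm (X : ℂ[X]) (_ : ℂ)]
  generalize (X : ℂ[X]) • mode A i v = w
  module

end Mode

/-! ### Finite-dimensionality of spaces on which the degree in $\lambda$ is bounded. -/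

section Finiteness

variable {M : Type*} [AddCommGroup M] [Module ℂ M] [Module ℂ[X] M] [IsScalarTower ℂ ℂ[X] M]

theorem C_smul_eq (c : ℂ) (v : M) : (C c : ℂ[X]) • v = c • v := by
  rw [← algebraMap_smul ℂ[X] c, algebraMap_eq]

/-- The sesquilinearity of the operator-valued polynomial `A` in its argument. -/
def IsSesq (A : M →ₗ[ℂ] PolynomialModule ℂ M) : Prop :=
  ∀ v l, (A ((X : ℂ[X]) • v)).eval l = (X + C l : ℂ[X]) • (A v).eval l

theorem IsSesq.eval_smul {A : M →ₗ[ℂ] PolynomialModule ℂ M} (hA : IsSesq A) (f : ℂ[X]) (v : M)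
    (l : ℂ) : (A (f • v)).eval l = taylor l f • (A v).eval l := by
  induction f using Polynomial.induction_on' generalizing v with
  | add p q hp hq => simp only [add_smul, map_add, hp, hq]
  | monomial n c =>
    rw [← C_mul_X_pow_eq_monomial]
    induction n generalizing v with
    | zero => simp [C_smul_eq]
    | succ n ih => rw [pow_succ, ← mul_assoc, mul_smul, ih, hA, taylor_mul l (_ * _),
        taylor_X, mul_smul]

/-- For fixed `x = ∂ + λ`, the polynomial `A_λ v` has bounded degree in `∂`. -/
theorem IsSesq.exists_natDegree_le [Module.Finite ℂ[X] M] {A : M →ₗ[ℂ] PolynomialModule ℂ M}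
    (hA : IsSesq A) (ψ : M →ₗ[ℂ[X]] ℂ[X]) :
    ∃ D : ℕ, ∀ (v : M) (x : ℂ), ∃ q : ℂ[X], q.natDegree ≤ D ∧
      ∀ c, (ψ ((A v).eval (x - c))).eval c = q.eval c := by
  have hbase : ∀ w : M, ∃ D : ℕ, ∀ x : ℂ, ∃ q : ℂ[X], q.natDegree ≤ D ∧
      ∀ c, (ψ ((A w).eval (x - c))).eval c = q.eval c := by
    intro w
    obtain ⟨n, hn⟩ := (eventually_coeff_eq_zero (A w)).exists
    refine ⟨n + ∑ i ∈ Finset.range n, (ψ ((A w).coeff i)).natDegree, fun x =>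
      ⟨∑ i ∈ Finset.range n, (C x - X) ^ i * ψ ((A w).coeff i), ?_, fun c => ?_⟩⟩
    · refine natDegree_sum_le_of_forall_le _ _ fun i hi => natDegree_mul_le.trans ?_
      refine add_le_add ?_ (Finset.single_le_sum
        (f := fun i => (ψ ((A w).coeff i)).natDegree) (fun _ _ => Nat.zero_le _) hi)
      refine natDegree_pow_le.trans ?_
      have h1 : (C x - X : ℂ[X]).natDegree ≤ 1 := by compute_degree
      calc i * (C x - X : ℂ[X]).natDegree ≤ i * 1 := Nat.mul_le_mul_left _ h1
        _ ≤ n := by rw [mul_one]; exact (Finset.mem_range.1 hi).le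
    · rw [eval_eq_sum_range _ hn, map_sum, eval_finsetSum, eval_finsetSum]
      refine Finset.sum_congr rfl fun i _ => ?_
      rw [← C_smul_eq, LinearMap.map_smul]
      simp
  choose d hd using hbase
  obtain ⟨S, hS⟩ := Module.Finite.fg_top (R := ℂ[X]) (M := M)
  refine ⟨S.sup d, fun v x => ?_⟩
  have hv : v ∈ Submodule.span ℂ[X] (S : Set M) := hS ▸ Submodule.mem_top
  induction hv using Submodule.span_induction with
  | mem w hw =>
    obtain ⟨q, hq, hq'⟩ := hd w x
    exact ⟨q, hq.trans (Finset.le_sup hw), hq'⟩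
  | zero => exact ⟨0, by simp, by simp⟩
  | add v w _ _ hv hw =>
    obtain ⟨q, hq, hq'⟩ := hv
    obtain ⟨r, hr, hr'⟩ := hw
    exact ⟨q + r, natDegree_add_le_of_degree_le hq hr, fun c => by simp [hq', hr']⟩
  | smul f v _ hv =>
    obtain ⟨q, hq, hq'⟩ := hv
    -- On the line $\partial+\lambda=x$ the factor $f(\partial+\lambda)$ is the scalar $f(x)$, so
    -- the degree does not grow. Hence the bound coming from finitely many generators is uniform in
    -- `v`.
    refine ⟨C (f.eval x) * q, (natDegree_C_mul_le _ _).trans hq, fun c => ?_⟩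
    rw [hA.eval_smul, LinearMap.map_smul, smul_eq_mul, eval_mul, hq', eval_mul, eval_C,
      taylor_eval, add_sub_cancel]

/-- Finitely many linear functionals detect whether `A_λ v` vanishes, as long as its degree in `λ`
is bounded. -/
theorem IsSesq.exists_detecting [Module.Finite ℂ[X] M] [Module.Free ℂ[X] M]
    {A : M →ₗ[ℂ] PolynomialModule ℂ M} (hA : IsSesq A) (N : ℕ) :
    ∃ (κ : Type) (_ : Finite κ) (Φ : M →ₗ[ℂ] κ → ℂ), ∀ v, (∀ n, N ≤ n → (A v).coeff n = 0) →
      Φ v = 0 → A v = 0 := by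
  let b := Module.finBasis ℂ[X] M
  choose D hD using fun i => hA.exists_natDegree_le (b.coord i)
  -- The functionals are the values at $\partial=0,\dots,D_i$ of the $i$-th coordinate of each of
  -- the first $N$ coefficients in $\lambda$.
  refine ⟨(i : Fin (Module.finrank ℂ[X] M)) × (Fin (D i + 1)) × (Fin N), inferInstance,
    LinearMap.pi fun k =>
      { toFun := fun v => (b.coord k.1 ((A v).coeff k.2.2)).eval (k.2.1 : ℂ)
        map_add' := fun v w => by simp
        map_smul' := fun c v => by
          rw [map_smul]
          change (b.coord k.1 (c • (A v).coeff k.2.2)).eval (k.2.1 : ℂ) = _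
          rw [← C_smul_eq, LinearMap.map_smul]
          simp }, fun v hv h0 => ?_⟩
  refine eq_of_forall_eval_eq fun l => ?_
  rw [map_zero]
  refine b.ext_elem fun i => ?_
  rw [map_zero, Finsupp.zero_apply]
  refine Polynomial.funext fun c => ?_
  -- The point $\partial=c$, $\lambda=l$ lies on the line $\partial+\lambda=c+l$. There the
  -- coordinate is a polynomial in $\partial$ of degree at most $D_i$ that vanishes at $D_i+1$
  -- points.
  obtain ⟨q, hq, hq'⟩ := hD i v (c + l)
  have h1 : ∀ (d : Fin (D i + 1)) (m : ℂ), ((b.coord i) ((A v).eval m)).eval (d : ℂ) = 0 := by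
    intro d m
    rw [eval_eq_sum_range _ hv, map_sum, eval_finsetSum]
    refine Finset.sum_eq_zero fun n hn => ?_
    have := congrFun h0 ⟨i, d, ⟨n, Finset.mem_range.1 hn⟩⟩
    rw [← C_smul_eq, LinearMap.map_smul, smul_eq_mul, eval_mul]
    exact mul_eq_zero_of_right _ this
  have hq0 : q = 0 := by
    refine Polynomial.eq_zero_of_natDegree_lt_card_of_eval_eq_zero q
      (f := fun d : Fin (D i + 1) => (d : ℂ)) ?_ (fun d => ?_) ?_
    · intro d e hde
      exact Fin.ext (Nat.cast_injective hde)
    · rw [← hq', h1]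
    · rw [Fintype.card_fin]
      omega
  have := hq' c
  rwa [add_sub_cancel_left, hq0] at this

/-- The detecting functionals of `A` and `B` together embed `U` in a finite-dimensional space. -/
theorem finiteDimensional_of_isSesq [Module.Finite ℂ[X] M] [Module.Free ℂ[X] M]
    {A B : M →ₗ[ℂ] PolynomialModule ℂ M} (hA : IsSesq A) (hB : IsSesq B) (N : ℕ)
    (h0 : ∀ v, A v = 0 → B v = 0 → v = 0) (U : Submodule ℂ M)
    (hUA : ∀ v ∈ U, ∀ n, N ≤ n → (A v).coeff n = 0)
    (hUB : ∀ v ∈ U, ∀ n, N ≤ n → (B v).coeff n = 0) : FiniteDimensional ℂ U := by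
  obtain ⟨κ, _, Φ, hΦ⟩ := hA.exists_detecting N
  obtain ⟨κ', _, Ψ, hΨ⟩ := hB.exists_detecting N
  refine FiniteDimensional.of_injective ((Φ.prod Ψ).comp U.subtype) ?_
  rw [← LinearMap.ker_eq_bot, LinearMap.ker_eq_bot']
  intro v hv
  have h1 : Φ v = 0 := congrArg Prod.fst hv
  have h2 : Ψ v = 0 := congrArg Prod.snd hv
  exact Subtype.ext (h0 v (hΦ v (hUA v v.2) h1) (hΨ v (hUB v v.2) h2))

end Finiteness

/-! ### Lie's theorem and common eigenvectors. -/

section LieTheorem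

attribute [local instance] LieRing.ofAssociativeRing

variable {V : Type*} [AddCommGroup V] [Module ℂ V]

theorem lie_mem_span_of_forall_mem {𝔤 : Type*} [LieRing 𝔤] [LieAlgebra ℂ 𝔤] {s : Set 𝔤}
    {P : Submodule ℂ 𝔤} (h : ∀ x ∈ s, ∀ y ∈ s, ⁅x, y⁆ ∈ P) {x y : 𝔤}
    (hx : x ∈ Submodule.span ℂ s) (hy : y ∈ Submodule.span ℂ s) : ⁅x, y⁆ ∈ P := by
  induction hx, hy using Submodule.span_induction₂ with
  | mem_mem x y hx hy => exact h x hx y hy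
  | zero_left y _ => simp
  | zero_right x _ => simp
  | add_left x y z _ _ _ h1 h2 => rw [add_lie]; exact P.add_mem h1 h2
  | add_right x y z _ _ _ h1 h2 => rw [lie_add]; exact P.add_mem h1 h2
  | smul_left r x y _ _ h1 => rw [smul_lie]; exact P.smul_mem r h1
  | smul_right r x y _ _ h1 => rw [lie_smul]; exact P.smul_mem r h1

/-- Lie's theorem for the linear span of a set of operators, with solvability witnessed by a
descending chain of sets. -/
theorem exists_common_eigenvector [FiniteDimensional ℂ V] [Nontrivial V]
    (G : ℕ → Set (Module.End ℂ V)) (hG : ∀ s, G (s + 1) ⊆ G s)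
    (hlie : ∀ s, ∀ x ∈ G s, ∀ y ∈ G s, ⁅x, y⁆ ∈ Submodule.span ℂ (G (s + 1)))
    {k : ℕ} (hk : ∀ x ∈ G k, x = 0) :
    ∃ v : V, v ≠ 0 ∧ ∀ x ∈ G 0, ∃ c : ℂ, x v = c • v := by
  let 𝔤 : LieSubalgebra ℂ (Module.End ℂ V) :=
    { Submodule.span ℂ (G 0) with
      lie_mem' := fun {x y} hx hy => Submodule.span_mono (hG 0)
        (lie_mem_span_of_forall_mem (hlie 0) hx hy) }
  have hder : ∀ s, ∀ x ∈ LieAlgebra.derivedSeries ℂ 𝔤 s,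
      (x : Module.End ℂ V) ∈ Submodule.span ℂ (G s) := by
    intro s
    induction s with
    | zero => exact fun x _ => x.2
    | succ s ih =>
      intro x hx
      rw [LieAlgebra.derivedSeries_def, LieAlgebra.derivedSeriesOfIdeal_succ,
        ← LieSubmodule.mem_toSubmodule, LieSubmodule.lieIdeal_oper_eq_linear_span'] at hx
      induction hx using Submodule.span_induction with
      | mem x hx =>
        obtain ⟨y, hy, z, hz, rfl⟩ := hx
        exact lie_mem_span_of_forall_mem (hlie s) (ih y hy) (ih z hz)
      | zero => exact Submodule.zero_mem _
      | add x y _ _ hx hy => exact Submodule.add_mem _ hx hy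
      | smul c x _ hx => exact Submodule.smul_mem _ c hx
  have : LieAlgebra.IsSolvable 𝔤 := by
    refine LieAlgebra.IsSolvable.mk (R := ℂ) (k := k) ?_
    rw [LieSubmodule.eq_bot_iff]
    intro x hx
    have h1 := hder k x hx
    rw [Submodule.span_eq_bot.2 hk, Submodule.mem_bot] at h1
    exact Subtype.ext h1
  obtain ⟨χ, hχ⟩ := LieModule.exists_nontrivial_weightSpace_of_isSolvable ℂ 𝔤 V
  obtain ⟨⟨v, hv⟩, hv0⟩ := exists_ne (0 : LieModule.weightSpace V χ)
  rw [LieModule.mem_weightSpace] at hv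
  exact ⟨v, fun h => hv0 (Subtype.ext h),
    fun x hx => ⟨_, hv ⟨x, Submodule.subset_span hx⟩⟩⟩

/-- A common eigenvector for a finite-dimensional representation of the half Witt algebra
`[L_i, L_j] = (i - j) L_{i+j}` extended by an abelian ideal `W` and an operator `T`. -/
theorem exists_common_eigenvector_of_witt [FiniteDimensional ℂ V] [Nontrivial V]
    {T : Module.End ℂ V} {L W : ℕ → Module.End ℂ V} {c : ℕ → ℕ → ℂ} {b : ℂ} {N : ℕ}
    (hLL : ∀ i j, ⁅L i, L j⁆ = ((i : ℂ) - j) • L (i + j))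
    (hLW : ∀ i j, ⁅L i, W j⁆ = c i j • W (i + j) + b • W (i + j + 1))
    (hWW : ∀ i j, ⁅W i, W j⁆ = 0) (hTL : ∀ i, ⁅T, L i⁆ = 0) (hTW : ∀ i, ⁅T, W i⁆ = b • W i)
    (hN : ∀ i, N ≤ i → L i = 0) :
    ∃ v : V, v ≠ 0 ∧ (∃ τ : ℂ, T v = τ • v) ∧ (∃ α : ℂ, L 0 v = α • v) ∧
      (∀ i, L (i + 1) v = 0) ∧ ∀ j, ∃ γ : ℂ, W j v = γ • v := by
  -- Each commutator drops `T` and raises the least index of the `L i`. The `W j` are kept through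
  -- stage `N + 1`, where all `L i` are zero and the `W j` commute; at stage `N + 2` only zero
  -- operators remain.
  let G : ℕ → Set (Module.End ℂ V) := fun s =>
    {x | (s = 0 ∧ x = T) ∨ (∃ i, s ≤ i ∧ x = L i) ∨ (s ≤ N + 1 ∧ ∃ j, x = W j)}
  have hev : ∃ v : V, v ≠ 0 ∧ ∀ x ∈ G 0, ∃ c : ℂ, x v = c • v := by
    refine exists_common_eigenvector (k := N + 2) G ?_ ?_ ?_
    · rintro s x (⟨h, -⟩ | ⟨i, hi, rfl⟩ | ⟨h, hj⟩)
      · omega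
      · exact Or.inr (Or.inl ⟨i, by omega, rfl⟩)
      · exact Or.inr (Or.inr ⟨by omega, hj⟩)
    · intro s
      have hmemL : ∀ i, s + 1 ≤ i → L i ∈ Submodule.span ℂ (G (s + 1)) := fun i hi =>
        Submodule.subset_span (Or.inr (Or.inl ⟨i, hi, rfl⟩))
      have hmemW : ∀ j, s ≤ N → W j ∈ Submodule.span ℂ (G (s + 1)) := fun j hs =>
        Submodule.subset_span (Or.inr (Or.inr ⟨by omega, j, rfl⟩))
      have hLW' : ∀ i j, s ≤ i → ⁅L i, W j⁆ ∈ Submodule.span ℂ (G (s + 1)) := by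
        intro i j hi
        rcases le_or_gt s N with hs | hs
        · rw [hLW]
          exact Submodule.add_mem _ (Submodule.smul_mem _ _ (hmemW _ hs))
            (Submodule.smul_mem _ _ (hmemW _ hs))
        · rw [hN i (by omega), zero_lie]
          exact Submodule.zero_mem _
      have hTW' : ∀ j, s = 0 → ⁅T, W j⁆ ∈ Submodule.span ℂ (G (s + 1)) := by
        intro j hs
        rw [hTW]
        exact Submodule.smul_mem _ _ (hmemW _ (by omega))
      rintro x (⟨h, rfl⟩ | ⟨i, hi, rfl⟩ | ⟨h, i, rfl⟩) y (⟨h', rfl⟩ | ⟨j, hj, rfl⟩ | ⟨h', j, rfl⟩)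
      · simp
      · simp [hTL]
      · exact hTW' j h
      · rw [← lie_skew, hTL]
        simp
      · rw [hLL]
        rcases eq_or_ne i j with rfl | hij
        · simp
        · exact Submodule.smul_mem _ _ (hmemL _ (by omega))
      · exact hLW' i j hi
      · rw [← lie_skew]
        exact Submodule.neg_mem _ (hTW' i h')
      · rw [← lie_skew]
        exact Submodule.neg_mem _ (hLW' j i hj)
      · simp [hWW]
    · rintro x (⟨h, -⟩ | ⟨i, hi, rfl⟩ | ⟨h, -⟩)
      · omega
      · exact hN i (by omega)
      · omega
  obtain ⟨v, hv0, hv⟩ := hev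
  have hL : ∀ i, ∃ α : ℂ, L i v = α • v := fun i =>
    hv _ (Or.inr (Or.inl ⟨i, Nat.zero_le _, rfl⟩))
  refine ⟨v, hv0, hv T (Or.inl ⟨rfl, rfl⟩), hL 0, fun i => ?_,
    fun j => hv _ (Or.inr (Or.inr ⟨Nat.zero_le _, j, rfl⟩))⟩
  obtain ⟨α, hα⟩ := hL 0
  obtain ⟨β, hβ⟩ := hL (i + 1)
  -- On a common eigenvector the commutator $[L_{i+1},L_0]=(i+1)L_{i+1}$ acts as zero, so the
  -- eigenvalue of $L_{i+1}$ is zero.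
  have h1 := congrArg (fun f : Module.End ℂ V => f v) (hLL (i + 1) 0)
  simp only [LieRing.of_associative_ring_bracket, LinearMap.sub_apply, Module.End.mul_apply, hα,
    hβ, map_smul, LinearMap.smul_apply, add_zero, Nat.cast_zero, sub_zero] at h1
  rw [smul_comm, sub_self] at h1
  rw [hβ]
  exact (smul_eq_zero.1 h1.symm).resolve_left (Nat.cast_ne_zero.2 i.succ_ne_zero)

end LieTheorem

/-- Comparing powers of $\lambda$ in $(\partial+\lambda-r)p(\lambda)=0$ gives
$p_i=-(\partial-r)p_{i+1}$, and the coefficients vanish from the top down. -/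
theorem eq_zero_of_forall_smul_eval_eq_zero {M : Type*} [AddCommGroup M] [Module ℂ M] [Module ℂ[X] M]
    [IsScalarTower ℂ ℂ[X] M] {p : PolynomialModule ℂ M} {r : ℂ}
    (h : ∀ l, (X + C l - C r : ℂ[X]) • p.eval l = 0) : p = 0 := by
  obtain ⟨n, hn⟩ := (eventually_coeff_eq_zero p).exists
  let φ : M →ₗ[ℂ] M := (LinearMap.lsmul ℂ[X] M (X - C r)).restrictScalars ℂ
  have h1 : (X : ℂ[X]) • p + PolynomialModule.map ℂ φ p = 0 := by
    refine eq_of_forall_eval_eq fun l => ?_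
    rw [map_zero, map_add, PolynomialModule.eval_map', PolynomialModule.eval_smul, eval_X, ← h l,
      ← C_smul_eq]
    change _ + (X - C r : ℂ[X]) • p.eval l = _
    rw [← add_smul]
    congr 1
    ring
  have h2 : ∀ i, p.coeff i = -φ (p.coeff (i + 1)) := by
    intro i
    have h3 := DFunLike.congr_fun (congrArg PolynomialModule.coeff h1) (i + 1)
    rw [PolynomialModule.coeff_add, Finsupp.add_apply, ← monomial_one_one_eq_X,
      PolynomialModule.monomial_smul_apply, if_pos (by omega), one_smul, Nat.add_sub_cancel] at h3
    exact eq_neg_of_add_eq_zero_left h3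
  have h4 : ∀ k, ∀ i, n ≤ i + k → p.coeff i = 0 := by
    intro k
    induction k with
    | zero => exact fun i hi => hn i hi
    | succ k ih => exact fun i hi => by rw [h2, ih (i + 1) (by omega), map_zero, neg_zero]
  ext i
  exact h4 n i (by omega)

/-- The generator `L` of `W(a, b)`. -/
abbrev genL : WCarrier := (1, 0)

/-- The generator `W` of `W(a, b)`. -/
abbrev genW : WCarrier := (0, 1)

/-! ### Action of the generators, trivially acted vectors and torsion. -/

section Action

variable {M : Type*} [AddCommGroup M] [Module ℂ M] [Module ℂ[X] M] [IsScalarTower ℂ ℂ[X] M]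
  {a b : ℂ} (ρ : ConformalModule (W a b) M)

theorem W_bracket (a b : ℂ) : (W a b).bracket = WBracket a b := rfl

theorem eval_act_smul {R : Type*} [AddCommGroup R] [Module ℂ R] [Module ℂ[X] R]
    [IsScalarTower ℂ ℂ[X] R] {A : LieConformalAlgebra R} (ρ : ConformalModule A M) (f : ℂ[X])
    (x : R) (v : M) (l : ℂ) :
    (ρ.act (f • x) v).eval l = f.eval (-l) • (ρ.act x v).eval l := by
  induction f using Polynomial.induction_on' generalizing x with
  | add p q hp hq => simp only [add_smul, map_add, LinearMap.add_apply, hp, hq, eval_add]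
  | monomial n c =>
    rw [← C_mul_X_pow_eq_monomial]
    induction n generalizing x with
    | zero => simp [C_smul_eq]
    | succ n ih =>
      rw [pow_succ, ← mul_assoc, mul_smul, ih, ρ.act_deriv_left, smul_smul, eval_mul (p := _ * _),
        eval_X]

theorem eval_act (x : WCarrier) (v : M) (l : ℂ) :
    (ρ.act x v).eval l =
      x.1.eval (-l) • (ρ.act genL v).eval l + x.2.eval (-l) • (ρ.act genW v).eval l := by
  have h : x = x.1 • genL + x.2 • genW := by ext1 <;> simp
  conv_lhs => rw [h]
  rw [map_add, LinearMap.add_apply, map_add, eval_act_smul, eval_act_smul]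

theorem isSesq_act (x : WCarrier) : IsSesq (ρ.act x) := fun v l => ρ.act_deriv_right x v l

/-- In $[x_\lambda y]_{\lambda+\mu}$ the operator $\partial$ becomes $-(\lambda+\mu)$, so
$\partial+2\lambda$ becomes $\lambda-\mu$. The coefficients are spelled out to match
`mode_commutator`. -/
theorem eval_act_L_L (v : M) (l m : ℂ) :
    (ρ.act genL ((ρ.act genL v).eval m)).eval l - (ρ.act genL ((ρ.act genL v).eval l)).eval m =
      (1 * l + (-1) * m + 0) • (ρ.act genL v).eval (l + m) := by
  rw [ρ.act_bracket, eval_act, W_bracket, eval_WBracket]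
  simp
  module

theorem eval_act_L_W (v : M) (l m : ℂ) :
    (ρ.act genL ((ρ.act genW v).eval m)).eval l - (ρ.act genW ((ρ.act genL v).eval l)).eval m =
      ((a - 1) * l + (-1) * m + b) • (ρ.act genW v).eval (l + m) := by
  rw [ρ.act_bracket, eval_act, W_bracket, eval_WBracket]
  simp
  module

theorem eval_act_W_W (v : M) (l m : ℂ) :
    (ρ.act genW ((ρ.act genW v).eval m)).eval l - (ρ.act genW ((ρ.act genW v).eval l)).eval m =
      (0 * l + 0 * m + 0) • (ρ.act genW v).eval (l + m) := by
  rw [ρ.act_bracket, eval_act, W_bracket, eval_WBracket]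
  simp

/-- The elements on which the conformal algebra acts trivially. -/
def actKer : Submodule ℂ[X] M where
  carrier := {v | ρ.act genL v = 0 ∧ ρ.act genW v = 0}
  zero_mem' := by simp
  add_mem' := fun {v w} hv hw => by simp [hv.1, hv.2, hw.1, hw.2]
  smul_mem' := fun f v hv => by
    refine ⟨eq_of_forall_eval_eq fun l => ?_, eq_of_forall_eval_eq fun l => ?_⟩
    · rw [(isSesq_act ρ _).eval_smul, hv.1, map_zero, smul_zero]
    · rw [(isSesq_act ρ _).eval_smul, hv.2, map_zero, smul_zero]

theorem act_eq_zero_of_mem_actKer {v : M} (hv : v ∈ actKer ρ) (x : WCarrier) : ρ.act x v = 0 :=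
  eq_of_forall_eval_eq fun l => by rw [eval_act, hv.1, hv.2]; simp

variable {ρ}

/-- The trivially acted vectors form a conformal submodule, which is not the whole of a nontrivial
module. -/
theorem actKer_eq_bot (hirr : ρ.IsIrreducible) (hnt : ¬ ρ.IsTrivial) : actKer ρ = ⊥ := by
  refine (hirr.2 (actKer ρ) fun x v hv n => ?_).resolve_right fun h => hnt fun x v => ?_
  · rw [act_eq_zero_of_mem_actKer ρ hv]
    exact Submodule.zero_mem _
  · exact act_eq_zero_of_mem_actKer ρ (h ▸ Submodule.mem_top) x

theorem eq_zero_of_act_eq_zero (hker : actKer ρ = ⊥) {v : M} (hL : ρ.act genL v = 0)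
    (hW : ρ.act genW v = 0) : v = 0 := by
  have : v ∈ actKer ρ := ⟨hL, hW⟩
  rwa [hker] at this

/-- Over $\mathbb{C}$ it is enough to treat linear factors. If $(\partial-r)v=0$, then
$(\partial+\lambda-r)x_\lambda v=0$, hence $x_\lambda v=0$ for all $x$. -/
theorem smul_eq_zero_of_actKer_eq_bot (hker : actKer ρ = ⊥) {f : ℂ[X]} (hf : f ≠ 0) {v : M}
    (h : f • v = 0) : v = 0 := by
  have hlin : ∀ (r : ℂ) (v : M), (X - C r : ℂ[X]) • v = 0 → v = 0 := by
    intro r v hv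
    have h1 : ∀ x, ρ.act x v = 0 := fun x => eq_zero_of_forall_smul_eval_eq_zero (r := r) fun l => by
      have h2 := (isSesq_act ρ x).eval_smul (X - C r) v l
      rw [hv, map_zero, map_zero, map_sub, taylor_X, taylor_C] at h2
      exact h2.symm
    exact eq_zero_of_act_eq_zero hker (h1 _) (h1 _)
  have hsplit := IsAlgClosed.splits f
  rw [hsplit.eq_prod_roots, mul_smul, C_smul_eq, smul_eq_zero_iff_right
    (leadingCoeff_ne_zero.2 hf)] at h
  generalize f.roots = s at h
  induction s using Multiset.induction_on with
  | empty => simpa using h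
  | cons r s ih =>
    rw [Multiset.map_cons, Multiset.prod_cons, mul_smul] at h
    exact ih (hlin r _ h)

theorem free_of_actKer_eq_bot [Module.Finite ℂ[X] M] (hker : actKer ρ = ⊥) :
    Module.Free ℂ[X] M := by
  have : Module.IsTorsionFree ℂ[X] M := by
    refine Module.IsTorsionFree.of_smul_eq_zero fun f v h => ?_
    by_contra! h'
    exact h'.2 (smul_eq_zero_of_actKer_eq_bot hker h'.1 h)
  infer_instance

end Action

/-! ### The mode algebra and a common eigenvector of the modes. -/

section Eigenvector

attribute [local instance] LieRing.ofAssociativeRing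

variable {M : Type*} [AddCommGroup M] [Module ℂ M] [Module ℂ[X] M] [IsScalarTower ℂ ℂ[X] M]
  {a b : ℂ} (ρ : ConformalModule (W a b) M)

/-- The mode `L_(n)`. -/
abbrev modeL (n : ℕ) : Module.End ℂ M := mode (ρ.act genL) n

/-- The mode `W_(n)`. -/
abbrev modeW (n : ℕ) : Module.End ℂ M := mode (ρ.act genW) n

/-- The operator `L_(0) - ∂`. -/
def shiftOp : Module.End ℂ M := modeL ρ 0 - (LinearMap.lsmul ℂ[X] M X).restrictScalars ℂ

theorem shiftOp_apply (v : M) : shiftOp ρ v = modeL ρ 0 v - (X : ℂ[X]) • v := rfl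

theorem modeL_modeL (i j : ℕ) (v : M) :
    modeL ρ i (modeL ρ j v) - modeL ρ j (modeL ρ i v) = ((i : ℂ) - j) • modeL ρ (i + j - 1) v := by
  rw [mode_commutator (eval_act_L_L ρ)]
  module

theorem modeL_modeW (i j : ℕ) (v : M) :
    modeL ρ i (modeW ρ j v) - modeW ρ j (modeL ρ i v) =
      ((a - 1) * i - j) • modeW ρ (i + j - 1) v + b • modeW ρ (i + j) v := by
  rw [mode_commutator (eval_act_L_W ρ)]
  module

theorem modeW_modeW (i j : ℕ) (v : M) : modeW ρ i (modeW ρ j v) = modeW ρ j (modeW ρ i v) := by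
  rw [← sub_eq_zero, mode_commutator (eval_act_W_W ρ)]
  module

/-- $L_{(0)}$ and $\partial$ have the same commutator $-jL_{(j-1)}$ with $L_{(j)}$. -/
theorem shiftOp_modeL (j : ℕ) (v : M) : shiftOp ρ (modeL ρ j v) = modeL ρ j (shiftOp ρ v) := by
  have h1 := modeL_modeL ρ 0 j v
  have h2 := mode_X_smul (isSesq_act ρ genL) j v
  rw [shiftOp_apply, shiftOp_apply, map_sub, h2, sub_eq_iff_eq_add.1 h1, zero_add, Nat.cast_zero]
  module

theorem shiftOp_modeW (j : ℕ) (v : M) :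
    shiftOp ρ (modeW ρ j v) = modeW ρ j (shiftOp ρ v) + b • modeW ρ j v := by
  have h1 := modeL_modeW ρ 0 j v
  have h2 := mode_X_smul (isSesq_act ρ genW) j v
  rw [shiftOp_apply, shiftOp_apply, map_sub, h2, sub_eq_iff_eq_add.1 h1, zero_add, Nat.cast_zero]
  module

/-- The vectors killed by the modes `L_(n)` with `n > N` and `W_(n)` with `n ≥ N`. -/
def annihilated (N : ℕ) : Submodule ℂ M where
  carrier := {v | (∀ n, N + 1 ≤ n → modeL ρ n v = 0) ∧ ∀ n, N ≤ n → modeW ρ n v = 0}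
  zero_mem' := by simp
  add_mem' := fun {v w} hv hw => ⟨fun n hn => by rw [map_add, hv.1 n hn, hw.1 n hn, add_zero],
    fun n hn => by rw [map_add, hv.2 n hn, hw.2 n hn, add_zero]⟩
  smul_mem' := fun c v hv => ⟨fun n hn => by rw [map_smul, hv.1 n hn, smul_zero],
    fun n hn => by rw [map_smul, hv.2 n hn, smul_zero]⟩

variable {ρ}

theorem shiftOp_mem_annihilated {N : ℕ} {v : M} (hv : v ∈ annihilated ρ N) :
    shiftOp ρ v ∈ annihilated ρ N := by
  refine ⟨fun n hn => ?_, fun n hn => ?_⟩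
  · rw [← shiftOp_modeL, hv.1 n hn, map_zero]
  · have h := shiftOp_modeW ρ n v
    rw [hv.2 n hn, map_zero, smul_zero, add_zero] at h
    exact h.symm

/-- Commuting with $L_{(i+1)}$ never lowers an index. $L_{(0)}$ would lower it, and is therefore
replaced by `shiftOp`. -/
theorem modeL_mem_annihilated {N : ℕ} {v : M} (hv : v ∈ annihilated ρ N) (i : ℕ) :
    modeL ρ (i + 1) v ∈ annihilated ρ N := by
  refine ⟨fun n hn => ?_, fun n hn => ?_⟩
  · have h := modeL_modeL ρ (i + 1) n v
    rwa [hv.1 n hn, hv.1 (i + 1 + n - 1) (by omega), map_zero, smul_zero, zero_sub,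
      neg_eq_zero] at h
  · have h := modeL_modeW ρ (i + 1) n v
    rwa [hv.2 n hn, hv.2 (i + 1 + n - 1) (by omega), hv.2 (i + 1 + n) (by omega), map_zero, smul_zero,
      smul_zero, add_zero, zero_sub, neg_eq_zero] at h

/-- The commutator of $L_{(n)}$ with $W_{(0)}$ involves $W_{(n-1)}$; this is why the threshold for
$L$ in `annihilated` is one higher than that for $W$. -/
theorem modeW_mem_annihilated {N : ℕ} {v : M} (hv : v ∈ annihilated ρ N) (i : ℕ) :
    modeW ρ i v ∈ annihilated ρ N := by
  refine ⟨fun n hn => ?_, fun n hn => ?_⟩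
  · have h := modeL_modeW ρ n i v
    rwa [hv.1 n hn, hv.2 (n + i - 1) (by omega), hv.2 (n + i) (by omega), map_zero, smul_zero,
      smul_zero, add_zero, sub_zero] at h
  · rw [modeW_modeW, hv.2 n hn, map_zero]

theorem finiteDimensional_annihilated [Module.Finite ℂ[X] M] (hker : actKer ρ = ⊥) (N : ℕ) :
    FiniteDimensional ℂ (annihilated ρ N) := by
  have := free_of_actKer_eq_bot hker
  refine finiteDimensional_of_isSesq (isSesq_act ρ genL) (isSesq_act ρ genW) (N + 1)
    (fun v => eq_zero_of_act_eq_zero hker) _ (fun v hv n hn => ?_) (fun v hv n hn => ?_)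
  · exact (mode_eq_zero_iff _ _ _).1 (hv.1 n hn)
  · exact (mode_eq_zero_iff _ _ _).1 (hv.2 n (by omega))

theorem exists_eigenvector_modes [Module.Finite ℂ[X] M] [Nontrivial M] (hker : actKer ρ = ⊥) :
    ∃ v : M, v ≠ 0 ∧ (∃ τ : ℂ, shiftOp ρ v = τ • v) ∧ (∃ α : ℂ, modeL ρ 1 v = α • v) ∧
      (∀ i, modeL ρ (i + 2) v = 0) ∧ ∀ j, ∃ γ : ℂ, modeW ρ j v = γ • v := by
  obtain ⟨v₀, hv₀⟩ := exists_ne (0 : M)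
  obtain ⟨N, hNL, hNW⟩ := ((eventually_mode_eq_zero (ρ.act genL) v₀).and
    (eventually_mode_eq_zero (ρ.act genW) v₀)).exists
  let U := annihilated ρ N
  have hv₀U : v₀ ∈ U := ⟨fun n hn => hNL n (by omega), hNW⟩
  have : FiniteDimensional ℂ U := finiteDimensional_annihilated hker N
  have : Nontrivial U := nontrivial_of_ne ⟨v₀, hv₀U⟩ 0 fun h => hv₀ (congrArg Subtype.val h)
  obtain ⟨v, hv0, ⟨τ, hτ⟩, ⟨α, hα⟩, hL, hW⟩ := exists_common_eigenvector_of_witt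
    (T := (shiftOp ρ).restrict (p := U) (q := U) fun v hv => shiftOp_mem_annihilated hv)
    -- Shifting the index of $L$ by one turns $L_{(i+j-1)}$ into the Witt form $L_{i+j}$.
    (L := fun i => (modeL ρ (i + 1)).restrict (p := U) (q := U)
      fun v hv => modeL_mem_annihilated hv i)
    (W := fun i => (modeW ρ i).restrict (p := U) (q := U)
      fun v hv => modeW_mem_annihilated hv i)
    (c := fun i j => (a - 1) * (i + 1 : ℕ) - j) (b := b) (N := N)
    (fun i j => by
      ext ⟨v, hv⟩
      have h := modeL_modeL ρ (i + 1) (j + 1) v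
      rw [show i + 1 + (j + 1) - 1 = i + j + 1 by omega] at h
      refine h.trans ?_
      push_cast
      rw [add_sub_add_right_eq_sub]
      rfl)
    (fun i j => by
      ext ⟨v, hv⟩
      have h := modeL_modeW ρ (i + 1) j v
      rw [show i + 1 + j - 1 = i + j by omega, show i + 1 + j = i + j + 1 by omega] at h
      exact h)
    (fun i j => by
      ext ⟨v, hv⟩
      exact sub_eq_zero.2 (modeW_modeW ρ i j v))
    (fun i => by
      ext ⟨v, hv⟩
      exact sub_eq_zero.2 (shiftOp_modeL ρ (i + 1) v))
    (fun i => by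
      ext ⟨v, hv⟩
      exact sub_eq_iff_eq_add'.2 (shiftOp_modeW ρ i v))
    (fun i hi => by
      ext ⟨v, hv⟩
      exact hv.1 (i + 1) (by omega))
  refine ⟨v, fun h => hv0 (Subtype.ext h), ⟨τ, congrArg Subtype.val hτ⟩,
    ⟨α, congrArg Subtype.val hα⟩, fun i => congrArg Subtype.val (hL i), fun j => ?_⟩
  obtain ⟨γ, hγ⟩ := hW j
  exact ⟨γ, congrArg Subtype.val hγ⟩

theorem exists_eigenvector [Module.Finite ℂ[X] M] [Nontrivial M] (hker : actKer ρ = ⊥) :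
    ∃ v : M, v ≠ 0 ∧ ∃ (α β : ℂ) (g : ℂ[X]),
      (∀ l, (ρ.act genL v).eval l = (X + C α * C l + C β : ℂ[X]) • v) ∧
      ∀ l, (ρ.act genW v).eval l = g.eval l • v := by
  obtain ⟨v, hv0, ⟨β, hβ⟩, ⟨α, hα⟩, hL, hW⟩ := exists_eigenvector_modes hker
  choose γ hγ using hW
  obtain ⟨N, hN⟩ := (eventually_mode_eq_zero (ρ.act genW) v).exists
  -- $\beta$ is the eigenvalue of $L_{(0)}-\partial$, $\alpha$ that of $L_{(1)}$, and $g$ is the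
  -- exponential generating polynomial of the eigenvalues of the $W_{(i)}$.
  refine ⟨v, hv0, α, β, ∑ i ∈ Finset.range N, C ((i.factorial : ℂ)⁻¹ * γ i) * X ^ i,
    fun l => ?_, fun l => ?_⟩
  · have h2 : ∀ i, 2 ≤ i → mode (ρ.act genL) i v = 0 := fun i hi => by
      obtain ⟨k, rfl⟩ := Nat.exists_eq_add_of_le' hi
      exact hL k
    rw [eval_eq_sum_mode _ v h2, Finset.sum_range_succ, Finset.sum_range_one]
    rw [shiftOp_apply, sub_eq_iff_eq_add] at hβ
    rw [hβ, hα, ← C_mul, add_smul, add_smul, C_smul_eq, C_smul_eq]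
    simp only [pow_zero, pow_one, Nat.factorial_zero, Nat.factorial_one, Nat.cast_one, div_one,
      one_smul, smul_smul, mul_comm l α]
    abel
  · rw [eval_eq_sum_mode _ v hN, eval_finsetSum, Finset.sum_smul]
    refine Finset.sum_congr rfl fun i _ => ?_
    rw [hγ, smul_smul, eval_C_mul, eval_pow, eval_X]
    congr 1
    ring

end Eigenvector

theorem coeff_map {M N : Type*} [AddCommGroup M] [Module ℂ M] [AddCommGroup N] [Module ℂ N]
    (f : M →ₗ[ℂ] N) (p : PolynomialModule ℂ M) (n : ℕ) :
    (PolynomialModule.map ℂ f p).coeff n = f (p.coeff n) := rfl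

theorem free_and_rank_eq_one {M : Type*} [AddCommGroup M] [Module ℂ[X] M] (e : ℂ[X] ≃ₗ[ℂ[X]] M) :
    Module.Free ℂ[X] M ∧ Module.rank ℂ[X] M = 1 := by
  refine ⟨Module.Free.of_equiv e, ?_⟩
  have h := LinearEquiv.lift_rank_eq e
  rw [Module.rank_self, Cardinal.lift_one] at h
  exact Cardinal.lift_eq_one.1 h.symm

/-! ### From values in $\lambda$ to coefficients, for submodules and isomorphisms. -/

section Conformal

variable {R : Type*} [AddCommGroup R] [Module ℂ R] [Module ℂ[X] R] [IsScalarTower ℂ ℂ[X] R]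
  {A : LieConformalAlgebra R}
  {M : Type*} [AddCommGroup M] [Module ℂ M] [Module ℂ[X] M] [IsScalarTower ℂ ℂ[X] M]
  {N : Type*} [AddCommGroup N] [Module ℂ N] [Module ℂ[X] N] [IsScalarTower ℂ ℂ[X] N]

theorem isSubmodule_of_eval_mem {ρ : ConformalModule A M} {U : Submodule ℂ[X] M}
    (h : ∀ x, ∀ u ∈ U, ∀ l, (ρ.act x u).eval l ∈ U) : ρ.IsSubmodule U := by
  intro x u hu n
  -- Modulo `U` the polynomial has only zero values, so its coefficients vanish there.
  have h1 : PolynomialModule.map ℂ (U.mkQ.restrictScalars ℂ) (ρ.act x u) = 0 := by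
    refine eq_of_forall_eval_eq fun l => ?_
    rw [map_zero]
    exact (PolynomialModule.eval_map ℂ _ _ l).trans
      ((Submodule.Quotient.mk_eq_zero U).2 (h x u hu l))
  have h2 := coeff_map (U.mkQ.restrictScalars ℂ) (ρ.act x u) n
  rw [h1] at h2
  exact (Submodule.Quotient.mk_eq_zero U).1 h2.symm

theorem isomorphic_of_eval {ρ : ConformalModule A M} {σ : ConformalModule A N} (e : M ≃ₗ[ℂ[X]] N)
    (h : ∀ x v l, e ((ρ.act x v).eval l) = (σ.act x (e v)).eval l) : ρ.Isomorphic σ := by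
  refine ⟨e, fun x v n => ?_⟩
  have h1 : PolynomialModule.map ℂ (e.toLinearMap.restrictScalars ℂ) (ρ.act x v) =
      σ.act x (e v) :=
    eq_of_forall_eval_eq fun l => (PolynomialModule.eval_map ℂ _ _ l).trans (h x v l)
  rw [← h1, coeff_map]
  rfl

end Conformal

/-! ### Reduction to rank one and determination of the parameters. -/

section RankOne

variable {M : Type*} [AddCommGroup M] [Module ℂ M] [Module ℂ[X] M] [IsScalarTower ℂ ℂ[X] M]
  {a b : ℂ} {ρ : ConformalModule (W a b) M}

theorem isSubmodule_span_singleton {w : M}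
    (hL : ∀ l, (ρ.act genL w).eval l ∈ Submodule.span ℂ[X] {w})
    (hW : ∀ l, (ρ.act genW w).eval l ∈ Submodule.span ℂ[X] {w}) :
    ρ.IsSubmodule (Submodule.span ℂ[X] {w}) := by
  refine isSubmodule_of_eval_mem fun x u hu l => ?_
  obtain ⟨f, rfl⟩ := Submodule.mem_span_singleton.1 hu
  rw [eval_act, (isSesq_act ρ _).eval_smul, (isSesq_act ρ _).eval_smul, ← C_smul_eq, ← C_smul_eq]
  exact Submodule.add_mem _ (Submodule.smul_mem _ _ (Submodule.smul_mem _ _ (hL l)))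
    (Submodule.smul_mem _ _ (Submodule.smul_mem _ _ (hW l)))

theorem exists_generator [Module.Finite ℂ[X] M] (hirr : ρ.IsIrreducible) (hnt : ¬ ρ.IsTrivial) :
    ∃ (v : M) (e : ℂ[X] ≃ₗ[ℂ[X]] M) (α β : ℂ) (g : ℂ[X]), (∀ f, e f = f • v) ∧
      (∀ l, (ρ.act genL v).eval l = (X + C α * C l + C β : ℂ[X]) • v) ∧
      ∀ l, (ρ.act genW v).eval l = g.eval l • v := by
  have := hirr.1
  have hker := actKer_eq_bot hirr hnt
  obtain ⟨v, hv0, α, β, g, hL, hW⟩ := exists_eigenvector hker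
  have htop : Submodule.span ℂ[X] {v} = ⊤ := by
    refine (hirr.2 _ (isSubmodule_span_singleton (fun l => ?_) fun l => ?_)).resolve_left
      fun h => hv0 (Submodule.span_singleton_eq_bot.1 h)
    · rw [hL]
      exact Submodule.smul_mem _ _ (Submodule.mem_span_singleton_self v)
    · rw [hW, ← C_smul_eq]
      exact Submodule.smul_mem _ _ (Submodule.mem_span_singleton_self v)
  refine ⟨v, LinearEquiv.ofBijective (LinearMap.toSpanSingleton ℂ[X] M v) ⟨?_, ?_⟩, α, β, g,
    fun f => rfl, hL, hW⟩
  · rw [← LinearMap.ker_eq_bot, LinearMap.ker_eq_bot']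
    intro f hf
    by_contra h
    exact hv0 (smul_eq_zero_of_actKer_eq_bot hker h hf)
  · intro w
    exact Submodule.mem_span_singleton.1 (htop ▸ Submodule.mem_top : w ∈ Submodule.span ℂ[X] {v})

variable {v : M} {e : ℂ[X] ≃ₗ[ℂ[X]] M} {α β : ℂ} {g : ℂ[X]}

/-- This is the $[L_\lambda W]$ axiom on the generator. Both coefficients of $v$ are constant in
$\partial$, so evaluating at $\partial=0$ loses nothing. -/
theorem symbol_relation (he : ∀ f, e f = f • v)
    (hL : ∀ l, (ρ.act genL v).eval l = (X + C α * C l + C β : ℂ[X]) • v)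
    (hW : ∀ l, (ρ.act genW v).eval l = g.eval l • v) (l m : ℂ) :
    -m * g.eval m = ((a - 1) * l - m + b) * g.eval (l + m) := by
  have h := eval_act_L_W ρ v l m
  rw [hW, hL, map_smul, map_smul, hL, (isSesq_act ρ _).eval_smul, hW, hW, ← C_smul_eq, ← C_smul_eq,
    ← C_smul_eq, ← C_smul_eq, smul_smul, smul_smul, smul_smul, ← sub_smul, ← he, ← he] at h
  have h1 := congrArg (Polynomial.eval 0) (e.injective h)
  simp only [map_add, taylor_X, taylor_mul, taylor_C, eval_sub, eval_mul, eval_add, eval_C,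
    eval_X] at h1
  linear_combination h1

theorem eval_act_smul_generator (hL : ∀ l, (ρ.act genL v).eval l = (X + C α * C l + C β : ℂ[X]) • v)
    (hW : ∀ l, (ρ.act genW v).eval l = g.eval l • v) (x : WCarrier) (f : ℂ[X]) (l : ℂ) :
    (ρ.act x (f • v)).eval l = (C (x.1.eval (-l)) * taylor l f * (X + C α * C l + C β) +
      C (x.2.eval (-l)) * taylor l f * C (g.eval l) : ℂ[X]) • v := by
  rw [eval_act, (isSesq_act ρ _).eval_smul, (isSesq_act ρ _).eval_smul, hL, hW, ← C_smul_eq,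
    ← C_smul_eq, ← C_smul_eq]
  simp only [smul_smul, ← add_smul, mul_assoc]

theorem ne_zero_of_isIrreducible (hirr : ρ.IsIrreducible) (he : ∀ f, e f = f • v)
    (hL : ∀ l, (ρ.act genL v).eval l = (X + C α * C l + C β : ℂ[X]) • v)
    (hW : ∀ l, (ρ.act genW v).eval l = g.eval l • v) : α ≠ 0 ∨ g ≠ 0 := by
  by_contra! h
  obtain ⟨rfl, rfl⟩ := h
  -- For $\alpha=0$ one has $L_\lambda v=(\partial+\beta)v$, so every value of $L_\lambda$ is a
  -- multiple of $(\partial+\beta)v$.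
  have hsub : ρ.IsSubmodule (Submodule.span ℂ[X] {(X + C β : ℂ[X]) • v}) := by
    refine isSubmodule_span_singleton (fun l => ?_) (fun l => ?_)
    · rw [(isSesq_act ρ _).eval_smul, hL, C_0, zero_mul, add_zero]
      exact Submodule.smul_mem _ _ (Submodule.mem_span_singleton_self _)
    · rw [(isSesq_act ρ _).eval_smul, hW, eval_zero, zero_smul, smul_zero]
      exact Submodule.zero_mem _
  rcases hirr.2 _ hsub with h | h
  · rw [Submodule.span_singleton_eq_bot, ← he, LinearEquiv.map_eq_zero_iff] at h
    exact X_add_C_ne_zero β h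
  · obtain ⟨f, hf⟩ := Submodule.mem_span_singleton.1
      (h ▸ Submodule.mem_top : v ∈ Submodule.span ℂ[X] {(X + C β : ℂ[X]) • v})
    have h1 : e (f * (X + C β)) = e 1 := by rw [he, he, mul_smul, hf, one_smul]
    have h2 := congrArg (Polynomial.eval (-β)) (e.injective h1)
    simp at h2

theorem eq_zero_of_symbol_relation (hab : a ≠ 1 ∨ b ≠ 0)
    (h : ∀ l m : ℂ, -m * g.eval m = ((a - 1) * l - m + b) * g.eval (l + m)) : g = 0 := by
  -- Setting $\mu=0$ leaves $((a-1)\lambda+b)g(\lambda)=0$, whose first factor is a nonzero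
  -- polynomial by `hab`.
  have h1 : (C (a - 1) * X + C b) * g = 0 := Polynomial.funext fun l => by
    have := h l 0
    simp only [neg_zero, zero_mul, sub_zero, add_zero] at this
    simpa using this.symm
  refine (mul_eq_zero.1 h1).resolve_left fun h2 => ?_
  have ha := congrArg (fun p => Polynomial.coeff p 1) h2
  have hb := congrArg (fun p => Polynomial.coeff p 0) h2
  simp at ha hb
  rcases hab with h | h
  · exact h (sub_eq_zero.1 ha)
  · exact h hb

theorem eq_C_of_symbol_relation
    (h : ∀ l m : ℂ, -m * g.eval m = ((1 - 1) * l - m + 0) * g.eval (l + m)) :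
    g = C (g.eval 1) := by
  refine Polynomial.funext fun x => ?_
  -- At $\mu=1$, $\lambda=x-1$ the relation reads $-g(1)=-g(x)$.
  have := h (x - 1) 1
  rw [sub_add_cancel] at this
  rw [eval_C]
  linear_combination this

end RankOne

end LieConf

end

/-! ### The classification. -/

open Polynomial LieConf in
theorem theorem3p1 {M : Type*} [AddCommGroup M] [Module ℂ M] [Module ℂ[X] M]
    [IsScalarTower ℂ ℂ[X] M] :
    (∀ a b : ℂ, (a ≠ 1 ∨ b ≠ 0) → ∀ ρ : ConformalModule (W a b) M,
      Module.Finite ℂ[X] M → ρ.IsIrreducible → ¬ ρ.IsTrivial →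
        Module.Free ℂ[X] M ∧ Module.rank ℂ[X] M = 1 ∧
          ∃ α β : ℂ, α ≠ 0 ∧ ρ.Isomorphic (Mab a b α β)) ∧
    (∀ ρ : ConformalModule (W 1 0) M,
      Module.Finite ℂ[X] M → ρ.IsIrreducible → ¬ ρ.IsTrivial →
        Module.Free ℂ[X] M ∧ Module.rank ℂ[X] M = 1 ∧
          ∃ α β γ : ℂ, (α ≠ 0 ∨ γ ≠ 0) ∧ ρ.Isomorphic (Mabc α β γ)) := by
  refine ⟨fun a b hab ρ _ hirr hnt => ?_, fun ρ _ hirr hnt => ?_⟩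
  · obtain ⟨v, e, α, β, g, he, hL, hW⟩ := exists_generator hirr hnt
    have hg : g = 0 := eq_zero_of_symbol_relation hab (symbol_relation he hL hW)
    refine ⟨(free_and_rank_eq_one e).1, (free_and_rank_eq_one e).2, α, β,
      (ne_zero_of_isIrreducible hirr he hL hW).resolve_right (not_not.2 hg),
      isomorphic_of_eval e.symm fun x w l => ?_⟩
    obtain ⟨f, rfl⟩ := e.surjective w
    rw [LinearEquiv.symm_apply_apply, LinearEquiv.symm_apply_eq, he, he,
      eval_act_smul_generator hL hW, hg]
    congr 1
    simp only [Mab, LinearMap.comp_apply, LinearMap.fst_apply, eval_sesq, eval_add, eval_mul,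
      eval_C, eval_X, eval_zero, C_0, mul_zero, add_zero]
  · obtain ⟨v, e, α, β, g, he, hL, hW⟩ := exists_generator hirr hnt
    obtain ⟨γ, rfl⟩ : ∃ γ, g = C γ := ⟨_, eq_C_of_symbol_relation (symbol_relation he hL hW)⟩
    refine ⟨(free_and_rank_eq_one e).1, (free_and_rank_eq_one e).2, α, β, γ,
      (ne_zero_of_isIrreducible hirr he hL hW).imp_right C_ne_zero.1,
      isomorphic_of_eval e.symm fun x w l => ?_⟩
    obtain ⟨f, rfl⟩ := e.surjective w
    rw [LinearEquiv.symm_apply_apply, LinearEquiv.symm_apply_eq, he, he,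
      eval_act_smul_generator hL hW]
    congr 1
    simp only [Mabc, LinearMap.add_apply, map_add, LinearMap.comp_apply, LinearMap.fst_apply,
      LinearMap.snd_apply, eval_sesq, eval_add, eval_mul, eval_C, eval_X]
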